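/- Consider $N$ agents in the plane with single-integrator dynamics $\dot x_i=u_i$, $x_i(t)\in\mathbb R^2$, $i\in\mathcal N=\{1,\dots,N\}$, $t\ge 0$, with communication radius $r$ and hysteresis constant $\varepsilon\in(0,r)$. The connectivity graph $G(t)=(\mathcal N,E(t))$ is undirected and is generated by the trajectories as follows. At $t=0$, two distinct agents $i,j$ form an edge iff $\|x_i(0)-x_j(0)\|<r$. At $t>0$, they form an edge iff either $\|x_i(t)-x_j(t)\|\le r-\varepsilon$, or $r-\varepsilon<\|x_i(t)-x_j(t)\|\le r$ and $(i,j)$ was already an edge immediately before $t$; a new edge appears only when the distance becomes at most $r-\varepsilon$. Equivalently: $(i,j)\in E(t)$ iff there is $s\in[0,t]$ such that ($s=0$ and $\|x_i(0)-x_j(0)\|<r$) or ($s>0$ and $\|x_i(s)-x_j(s)\|\le r-\varepsilon$), and $\|x_i(u)-x_j(u)\|\le r$ for all $u\in[s,t]$. Let $\mathcal N_i(t)=\{j : (i,j)\in E(t)\}$. Let $\ell\in\mathcal N$ be the fixed leader for all $t\ge T_1$, where $T_1\ge 0$, and let $R_{\ell g}=\{y\in\mathbb R^2 : \|y-c_{\ell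 g}\|\le r_{\ell g}\}$, $r_{\ell g}>0$, be its goal region. Suppose that for $t\ge T_1$ the agents are driven by the controller $$u_i(t)=-b_i\,(x_i-c_{ig})-\sum_{j\in\mathcal N_i(t)}\frac{2r^2}{(r^2-\|x_i-x_j\|^2)^2}\,(x_i-x_j),\qquad b_\ell=1,\quad b_i=0\ (i\ne\ell),$$ the closed-loop system being understood in the sense of Carathéodory, i.e. each $u_i$ is locally integrable on $[T_1,\infty)$ and $x_i(t)=x_i(T_1)+\int_{T_1}^t u_i(s)\,ds$ for all $t\ge T_1$. Suppose that $G(T_1)$ is connected and that every edge $(i,j)\in E(T_1)$ satisfies $\|x_i(T_1)-x_j(T_1)\|<r$, so that the controller is defined at time $T_1$. Then there is a finite time $\bar t\ge T_1$ such that $x_i(\bar t)\in R_{\ell g}$ for all $i\in\mathcal N$. Moreover, $x_i(t)\to c_{\ell g}$ as $t\to\infty$ for every $i\in\mathcal N$. -/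

import Mathlib

open Set Filter Topology

/-- The plane in which the agents move, with its Euclidean norm. -/
abbrev Plane : Type := EuclideanSpace ℝ (Fin 2)

namespace LeaderFollower

/-- A potential edge `{i, j}` is switched on at time `s`: at time `0` when the distance is `< r`,
at a time `s > 0` when the distance is `≤ r - ε`. -/
def SwitchOn {N : ℕ} (r ε : ℝ) (x : ℝ → Fin N → Plane) (s : ℝ) (i j : Fin N) : Prop :=
  (s = 0 ∧ ‖x s i - x s j‖ < r) ∨ (0 < s ∧ ‖x s i - x s j‖ ≤ r - ε)

/-- The connectivity graph `G(t)` generated by the trajectories `x` (communication radius `r`,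
hysteresis width `ε`): `{i, j}` is an edge at time `t` iff it was switched on at some time
`s ∈ [0, t]` and the distance of the two agents has not exceeded `r` since then.
The next three lemmas show that this graph obeys the recursive hysteresis rule
and that an edge can only appear by being switched on. -/
def connGraph {N : ℕ} (r ε : ℝ) (x : ℝ → Fin N → Plane) (t : ℝ) : SimpleGraph (Fin N) where
  Adj i j := i ≠ j ∧ ∃ s ∈ Icc 0 t, SwitchOn r ε x s i j ∧ ∀ u ∈ Icc s t, ‖x u i - x u j‖ ≤ r
  symm := ⟨by
    rintro i j ⟨hij, s, hs, h, hu⟩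
    refine ⟨hij.symm, s, hs, ?_, fun u hu' => ?_⟩
    · unfold SwitchOn at h ⊢
      rwa [norm_sub_rev]
    · rw [norm_sub_rev]
      exact hu u hu'⟩
  loopless := ⟨fun _ h => h.1 rfl⟩

theorem connGraph_zero {N : ℕ} (r ε : ℝ) (x : ℝ → Fin N → Plane) (i j : Fin N) :
    (connGraph r ε x 0).Adj i j ↔ i ≠ j ∧ ‖x 0 i - x 0 j‖ < r := by
  constructor
  · rintro ⟨hij, s, hs, h, -⟩
    have hs0 : s = 0 := le_antisymm hs.2 hs.1
    subst hs0
    rcases h with h | h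
    · exact ⟨hij, h.2⟩
    · exact absurd h.1 (lt_irrefl _)
  · rintro ⟨hij, h⟩
    refine ⟨hij, 0, ⟨le_rfl, le_rfl⟩, Or.inl ⟨rfl, h⟩, fun u hu => ?_⟩
    have hu0 : u = 0 := le_antisymm hu.2 hu.1
    subst hu0
    exact h.le

theorem connGraph_pos {N : ℕ} {r ε : ℝ} (hε : 0 < ε) (x : ℝ → Fin N → Plane) {t : ℝ}
    (ht : 0 < t) (i j : Fin N) :
    (connGraph r ε x t).Adj i j ↔ i ≠ j ∧ (‖x t i - x t j‖ ≤ r - ε ∨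
      ((r - ε < ‖x t i - x t j‖ ∧ ‖x t i - x t j‖ ≤ r) ∧
        ∀ᶠ s in 𝓝[<] t, (connGraph r ε x s).Adj i j)) := by
  constructor
  · rintro ⟨hij, s, hs, h, hu⟩
    refine ⟨hij, ?_⟩
    rcases le_or_gt ‖x t i - x t j‖ (r - ε) with hd | hd
    · exact Or.inl hd
    have hdr := hu t ⟨hs.2, le_rfl⟩
    refine Or.inr ⟨⟨hd, hdr⟩, ?_⟩
    have hst : s < t := by
      refine lt_of_le_of_ne hs.2 ?_
      rintro rfl
      rcases h with h | h
      · exact ht.ne' h.1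
      · exact absurd h.2 (not_le.mpr hd)
    filter_upwards [Ico_mem_nhdsLT hst] with v hv
    exact ⟨hij, s, ⟨hs.1, hv.1⟩, h, fun w hw => hu w ⟨hw.1, hw.2.trans hv.2.le⟩⟩
  · rintro ⟨hij, hd | ⟨⟨-, hdr⟩, hev⟩⟩
    · refine ⟨hij, t, ⟨ht.le, le_rfl⟩, Or.inr ⟨ht, hd⟩, fun u hu => ?_⟩
      have hut : u = t := le_antisymm hu.2 hu.1
      subst hut
      linarith
    · obtain ⟨a, hat, ha⟩ := (mem_nhdsLT_iff_exists_Ioo_subset).1 hev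
      have hat' : a < t := hat
      obtain ⟨-, s, hs, h, hu⟩ := ha (show (a + t) / 2 ∈ Ioo a t from
        ⟨by linarith, by linarith⟩)
      refine ⟨hij, s, ⟨hs.1, by linarith [hs.2]⟩, h, fun u hu' => ?_⟩
      rcases le_or_gt u ((a + t) / 2) with h1 | h1
      · exact hu u ⟨hu'.1, h1⟩
      rcases hu'.2.eq_or_lt with h2 | h2
      · rw [h2]
        exact hdr
      · obtain ⟨-, s', hs', -, hu2⟩ := ha (show u ∈ Ioo a t from ⟨by linarith, h2⟩)
        exact hu2 u ⟨hs'.2, le_rfl⟩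

theorem connGraph_new_edge {N : ℕ} {r ε : ℝ} (x : ℝ → Fin N → Plane) {s t : ℝ}
    (hs : 0 ≤ s) (hst : s < t) (i j : Fin N) (h0 : ¬ (connGraph r ε x s).Adj i j)
    (h1 : (connGraph r ε x t).Adj i j) : ∃ u ∈ Ioc s t, ‖x u i - x u j‖ ≤ r - ε := by
  obtain ⟨hij, v, hv, hon, hle⟩ := h1
  rcases le_or_gt v s with hvs | hvs
  · exact absurd ⟨hij, v, ⟨hv.1, hvs⟩, hon, fun w hw => hle w ⟨hw.1, hw.2.trans hst.le⟩⟩ h0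
  · rcases hon with h | h
    · exact absurd h.1 (hs.trans_lt hvs).ne'
    · exact ⟨v, ⟨hvs, hv.2⟩, h.2⟩

open Classical in
/-- The controller
`uᵢ(t) = -bᵢ (xᵢ - cᵢ) - ∑_{j ∈ 𝒩ᵢ(t)} 2 r² / (r² - ‖xᵢ - xⱼ‖²)² (xᵢ - xⱼ)`,
where `𝒩ᵢ(t)` is the set of neighbours of `i` in `G(t)`. -/
noncomputable def controlInput {N : ℕ} (r ε : ℝ) (b : Fin N → ℝ) (c : Fin N → Plane)
    (x : ℝ → Fin N → Plane) (t : ℝ) (i : Fin N) : Plane :=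
  -(b i • (x t i - c i)) -
    ∑ j ∈ Finset.univ.filter (fun j => (connGraph r ε x t).Adj i j),
      (2 * r ^ 2 / (r ^ 2 - ‖x t i - x t j‖ ^ 2) ^ 2) • (x t i - x t j)

/-- The leader indicator: `1` for the leader `ℓ`, `0` for the followers. -/
def leaderIndicator {N : ℕ} (l : Fin N) (i : Fin N) : ℝ := if i = l then 1 else 0

/-- From time `T₁` on, the agents `ẋᵢ = uᵢ` are driven by the controller with the fixed leader `l`.
The right-hand side jumps when an edge is added, so the equation is understood in the sense of
Carathéodory: `xᵢ` is the integral of the locally integrable input `uᵢ`. -/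
def IsClosedLoopFrom {N : ℕ} (r ε : ℝ) (l : Fin N) (c : Fin N → Plane) (T₁ : ℝ)
    (x : ℝ → Fin N → Plane) : Prop :=
  ∀ i, ∀ t, T₁ ≤ t →
    IntervalIntegrable (fun s => controlInput r ε (leaderIndicator l) c x s i)
      MeasureTheory.volume T₁ t ∧
    x t i = x T₁ i + ∫ s in T₁..t, controlInput r ε (leaderIndicator l) c x s i

/-- The circular goal region with center `c` and radius `ρ`. -/
def goalRegion (c : Plane) (ρ : ℝ) : Set Plane := {y | ‖y - c‖ ≤ ρ}

end LeaderFollower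

namespace LeaderFollower

/-! The closed loop is a gradient flow of half the squared leader error plus edge barriers `r² / (r²
- d²)`. Shifting each barrier to vanish at `d = r - ε`, where edges are born, makes this energy
continuous across switchings, with right derivative `-∑ ‖uᵢ‖²` (`loopEnergy_le`). Bounded energy
keeps every edge shorter than `r`, so no edge is ever lost (`norm_sub_lt_of_adj`, `connGraph_mono`).

Hence the connected graph `G(T₁)` persists, with weights at least `2 / r²`. For `yᵢ = xᵢ - c l`, the
right derivative of `∑ ‖yᵢ‖²` is `-2‖y_l‖² - ∑ᵢⱼ wᵢⱼ ‖yᵢ - yⱼ‖²`, and a Poincaré inequality on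
`G(T₁)` (`exists_sum_norm_sq_le`) turns this into exponential decay.

Continuity and right derivatives suffice for both monotonicity arguments, so switching times need
not be counted. -/

theorem le_of_deriv_right_nonpos {f f' : ℝ → ℝ} {a b : ℝ} (hab : a ≤ b)
    (hf : ContinuousOn f (Icc a b))
    (hf' : ∀ t ∈ Ico a b, HasDerivWithinAt f (f' t) (Ici t) t)
    (hle : ∀ t ∈ Ico a b, f' t ≤ 0) : f b ≤ f a :=
  image_le_of_deriv_right_le_deriv_boundary (B := fun _ => f a) (B' := fun _ => 0) hf hf' le_rfl
    continuousOn_const (fun t _ => hasDerivWithinAt_const t _ _) hle ⟨hab, le_rfl⟩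

/-! ### Right-continuity and persistence of the hysteresis graph -/

/-- An edge shorter than `r` needs time to reach `r`; a non-edge is strictly farther apart than `r -
ε` and needs time to get there. -/
theorem connGraph_adj_iff_eventually_right {N : ℕ} {r ε : ℝ} (hε : 0 < ε)
    {x : ℝ → Fin N → Plane} {t : ℝ} (ht : 0 ≤ t) {i j : Fin N}
    (hx : ContinuousWithinAt (fun s => ‖x s i - x s j‖) (Ici t) t)
    (hlt : (connGraph r ε x t).Adj i j → ‖x t i - x t j‖ < r) :
    ∀ᶠ s in 𝓝[≥] t, ((connGraph r ε x s).Adj i j ↔ (connGraph r ε x t).Adj i j) := by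
  by_cases h : (connGraph r ε x t).Adj i j
  · obtain ⟨b, hb, hsub⟩ := mem_nhdsGE_iff_exists_Ico_subset.1
      (hx.eventually (eventually_lt_nhds (hlt h)))
    filter_upwards [Ico_mem_nhdsGE hb] with s hs
    refine ⟨fun _ => h, fun _ => ?_⟩
    obtain ⟨hij, v, hv, hon, hle⟩ := h
    refine ⟨hij, v, ⟨hv.1, hv.2.trans hs.1⟩, hon, fun u hu => ?_⟩
    rcases le_or_gt u t with hut | hut
    · exact hle u ⟨hu.1, hut⟩
    · exact (hsub ⟨hut.le, hu.2.trans_lt hs.2⟩ : ‖x u i - x u j‖ < r).le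
  · by_cases hij : i = j
    · subst hij
      exact Eventually.of_forall fun s => by simp
    have hd : r - ε < ‖x t i - x t j‖ := by
      by_contra! hd
      rcases ht.eq_or_lt with rfl | h0
      · exact h ((connGraph_zero r ε x i j).2 ⟨hij, by linarith⟩)
      · exact h ((connGraph_pos hε x h0 i j).2 ⟨hij, Or.inl hd⟩)
    obtain ⟨b, hb, hsub⟩ := mem_nhdsGE_iff_exists_Ico_subset.1
      (hx.eventually (eventually_gt_nhds hd))
    filter_upwards [Ico_mem_nhdsGE hb] with s hs
    refine ⟨fun hadj => ?_, fun h' => absurd h' h⟩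
    rcases hs.1.eq_or_lt with rfl | hts
    · exact hadj
    obtain ⟨u, hu, hle⟩ := connGraph_new_edge x ht hts i j h hadj
    exact absurd hle (not_le.2 (hsub ⟨hu.1.le, hu.2.trans_lt hs.2⟩))

theorem connGraph_mono {N : ℕ} {r ε : ℝ} {x : ℝ → Fin N → Plane} {a t : ℝ}
    (hat : a ≤ t) {i j : Fin N}
    (hx : ContinuousOn (fun s => ‖x s i - x s j‖) (Icc a t))
    (hlt : ∀ s ∈ Icc a t, (connGraph r ε x s).Adj i j → ‖x s i - x s j‖ < r)
    (h : (connGraph r ε x a).Adj i j) : (connGraph r ε x t).Adj i j := by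
  have extend : ∀ s ∈ Icc a t, (∀ u ∈ Icc a s, ‖x u i - x u j‖ ≤ r) →
      (connGraph r ε x s).Adj i j := by
    intro s hs hle
    obtain ⟨hij, v, hv, hon, hvle⟩ := h
    refine ⟨hij, v, ⟨hv.1, hv.2.trans hs.1⟩, hon, fun u hu => ?_⟩
    rcases le_or_gt u a with hua | hua
    · exact hvle u ⟨hu.1, hua⟩
    · exact hle u ⟨hua.le, hu.2⟩
  refine extend t ⟨hat, le_rfl⟩ ?_
  by_contra! hne
  obtain ⟨u, hu, hur⟩ := hne
  have hclosed : IsClosed (Icc a t ∩ (fun s => ‖x s i - x s j‖) ⁻¹' Ici r) :=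
    hx.preimage_isClosed_of_isClosed isClosed_Icc isClosed_Ici
  have hcpt : IsCompact (Icc a t ∩ (fun s => ‖x s i - x s j‖) ⁻¹' Ici r) :=
    isCompact_Icc.of_isClosed_subset hclosed inter_subset_left
  -- At the first time `m` with distance at least `r`, continuity gives distance at most `r`, so the
  -- edge is still present and `hlt` applies at `m` itself.
  obtain ⟨m, ⟨hm, hmr⟩, hmin⟩ := hcpt.exists_isLeast ⟨u, hu, hur.le⟩
  have hbefore : ∀ s ∈ Ico a m, ‖x s i - x s j‖ < r := fun s hs => by
    by_contra! hs'
    exact absurd (hmin ⟨⟨hs.1, hs.2.le.trans hm.2⟩, hs'⟩) (not_le.2 hs.2)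
  have ham : a < m := by
    refine lt_of_le_of_ne hm.1 ?_
    rintro rfl
    exact absurd (hlt a hm h) (not_lt.2 hmr)
  have hmle : ‖x m i - x m j‖ ≤ r := by
    have hcont : ContinuousWithinAt (fun s => ‖x s i - x s j‖) (Ico a m) m :=
      (hx m hm).mono fun s hs => ⟨hs.1, hs.2.le.trans hm.2⟩
    have : (𝓝[Ico a m] m).NeBot := by
      rw [nhdsWithin_Ico_eq_nhdsLT ham]
      infer_instance
    exact le_of_tendsto hcont (by
      filter_upwards [self_mem_nhdsWithin] with s hs using (hbefore s hs).le)
  refine absurd (hlt m hm (extend m hm fun s hs => ?_)) (not_lt.2 hmr)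
  rcases hs.2.eq_or_lt with rfl | h'
  · exact hmle
  · exact (hbefore s ⟨hs.1, h'⟩).le

/-! ### Weighted Laplacian and a Poincaré inequality -/

open Classical in
/-- The coupling weight of the pair `{i, j}` at time `t`, zero when it is not an edge. -/
noncomputable def edgeWeight {N : ℕ} (r ε : ℝ) (x : ℝ → Fin N → Plane) (t : ℝ)
    (i j : Fin N) : ℝ :=
  if (connGraph r ε x t).Adj i j then 2 * r ^ 2 / (r ^ 2 - ‖x t i - x t j‖ ^ 2) ^ 2 else 0

theorem edgeWeight_symm {N : ℕ} (r ε : ℝ) (x : ℝ → Fin N → Plane) (t : ℝ) (i j : Fin N) :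
    edgeWeight r ε x t i j = edgeWeight r ε x t j i := by
  unfold edgeWeight
  rw [norm_sub_rev, SimpleGraph.adj_comm]

theorem edgeWeight_nonneg {N : ℕ} (r ε : ℝ) (x : ℝ → Fin N → Plane) (t : ℝ) (i j : Fin N) :
    0 ≤ edgeWeight r ε x t i j := by
  unfold edgeWeight
  split_ifs <;> positivity

theorem two_div_sq_le_edgeWeight {N : ℕ} {r ε : ℝ} {x : ℝ → Fin N → Plane} {t : ℝ} {i j : Fin N}
    (h : (connGraph r ε x t).Adj i j) (hlt : ‖x t i - x t j‖ < r) :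
    2 / r ^ 2 ≤ edgeWeight r ε x t i j := by
  have h0 := norm_nonneg (x t i - x t j)
  have hr : 0 < r := h0.trans_lt hlt
  have hpos : 0 < r ^ 2 - ‖x t i - x t j‖ ^ 2 := by nlinarith
  rw [edgeWeight, if_pos h, div_le_div_iff₀ (by positivity) (by positivity)]
  have : (r ^ 2 - ‖x t i - x t j‖ ^ 2) ^ 2 ≤ (r ^ 2) ^ 2 := by
    gcongr
    nlinarith
  nlinarith

theorem controlInput_eq {N : ℕ} (r ε : ℝ) (b : Fin N → ℝ) (c : Fin N → Plane)
    (x : ℝ → Fin N → Plane) (t : ℝ) (i : Fin N) :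
    controlInput r ε b c x t i =
      -(b i • (x t i - c i)) - ∑ j, edgeWeight r ε x t i j • (x t i - x t j) := by
  simp only [controlInput, edgeWeight, Finset.sum_filter, ite_smul, zero_smul]

theorem sum_inner_laplacian {ι E : Type*} [Fintype ι] [NormedAddCommGroup E]
    [InnerProductSpace ℝ E] {w : ι → ι → ℝ} (hw : ∀ i j, w i j = w j i) (y v : ι → E) :
    ∑ i, inner ℝ (∑ j, w i j • (y i - y j)) (v i) =
      (∑ i, ∑ j, w i j * inner ℝ (y i - y j) (v i - v j)) / 2 := by
  have h1 : ∀ i, inner ℝ (∑ j, w i j • (y i - y j)) (v i) =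
      ∑ j, w i j * inner ℝ (y i - y j) (v i) := fun i => by
    simp only [sum_inner, real_inner_smul_left]
  have h2 : ∑ i, ∑ j, w i j * inner ℝ (y i - y j) (v j) =
      -∑ i, ∑ j, w i j * inner ℝ (y i - y j) (v i) := by
    rw [Finset.sum_comm, ← Finset.sum_neg_distrib]
    refine Finset.sum_congr rfl fun i _ => ?_
    rw [← Finset.sum_neg_distrib]
    refine Finset.sum_congr rfl fun j _ => ?_
    rw [hw j i, ← neg_sub (y i) (y j), inner_neg_left]
    ring
  simp only [h1, inner_sub_right (𝕜 := ℝ) (y _ - y _), mul_sub, Finset.sum_sub_distrib, h2]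
  ring

/-- Differences are added up along a walk from each vertex to `l`. The constant is chosen before
`w`, so one value serves all times although the weights vary. -/
theorem exists_sum_norm_sq_le {V E : Type*} [Fintype V] [NormedAddCommGroup E]
    {G : SimpleGraph V} (hG : G.Connected) (l : V) {a : ℝ} (ha : 0 < a) :
    ∃ C : ℝ, 0 < C ∧ ∀ (w : V → V → ℝ) (y : V → E), (∀ i j, 0 ≤ w i j) →
      (∀ i j, G.Adj i j → a ≤ w i j) →
      ∑ i, ‖y i‖ ^ 2 ≤ C * (2 * ‖y l‖ ^ 2 + ∑ i, ∑ j, w i j * ‖y i - y j‖ ^ 2) := by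
  have key : ∀ i, ∃ C : ℝ, 0 < C ∧ ∀ (w : V → V → ℝ) (y : V → E), (∀ i j, 0 ≤ w i j) →
      (∀ i j, G.Adj i j → a ≤ w i j) →
      ‖y i‖ ^ 2 ≤ C * (2 * ‖y l‖ ^ 2 + ∑ i, ∑ j, w i j * ‖y i - y j‖ ^ 2) := by
    intro i
    obtain ⟨p⟩ := hG.preconnected i l
    induction p with
    | nil =>
      refine ⟨1, one_pos, fun w y hw _ => ?_⟩
      have : 0 ≤ ∑ i, ∑ j, w i j * ‖y i - y j‖ ^ 2 :=
        Finset.sum_nonneg fun i _ => Finset.sum_nonneg fun j _ =>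
          mul_nonneg (hw i j) (by positivity)
      nlinarith [sq_nonneg ‖y ‹V›‖]
    | @cons u v z huv p ih =>
      obtain ⟨C, hC, h⟩ := ih
      refine ⟨2 * C + 2 / a, by positivity, fun w y hw hwG => ?_⟩
      have h1 := h w y hw hwG
      have hterm : w u v * ‖y u - y v‖ ^ 2 ≤ ∑ i, ∑ j, w i j * ‖y i - y j‖ ^ 2 :=
        (Finset.single_le_sum (f := fun j => w u j * ‖y u - y j‖ ^ 2)
          (fun j _ => mul_nonneg (hw u j) (by positivity)) (Finset.mem_univ v)).trans
        (Finset.single_le_sum (f := fun i => ∑ j, w i j * ‖y i - y j‖ ^ 2)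
          (fun i _ => Finset.sum_nonneg fun j _ => mul_nonneg (hw i j) (by positivity))
          (Finset.mem_univ u))
      have hedge : ‖y u - y v‖ ^ 2 ≤
          1 / a * (2 * ‖y z‖ ^ 2 + ∑ i, ∑ j, w i j * ‖y i - y j‖ ^ 2) := by
        rw [one_div, ← div_eq_inv_mul, le_div_iff₀ ha]
        nlinarith [mul_le_mul_of_nonneg_right (hwG u v huv) (sq_nonneg ‖y u - y v‖),
          sq_nonneg ‖y z‖]
      have htri : ‖y u‖ ≤ ‖y v‖ + ‖y u - y v‖ := by
        simpa using norm_add_le (y v) (y u - y v)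
      have hsq : ‖y u‖ ^ 2 ≤ 2 * ‖y v‖ ^ 2 + 2 * ‖y u - y v‖ ^ 2 := by
        nlinarith [norm_nonneg (y u), sq_nonneg (‖y v‖ - ‖y u - y v‖)]
      calc ‖y u‖ ^ 2 ≤ _ := hsq
        _ ≤ _ := add_le_add (mul_le_mul_of_nonneg_left h1 zero_le_two)
            (mul_le_mul_of_nonneg_left hedge zero_le_two)
        _ = _ := by ring
  choose C hC h using key
  have : Nonempty V := ⟨l⟩
  refine ⟨∑ i, C i, Finset.sum_pos (fun i _ => hC i) Finset.univ_nonempty, fun w y hw hwG => ?_⟩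
  rw [Finset.sum_mul]
  exact Finset.sum_le_sum fun i _ => h i w y hw hwG

/-! ### One-sided regularity of the closed loop -/

variable {N : ℕ} {r ε : ℝ} {l : Fin N} {c : Fin N → Plane} {T₁ : ℝ} {x : ℝ → Fin N → Plane}

theorem IsClosedLoopFrom.continuousOn (hloop : IsClosedLoopFrom r ε l c T₁ x) (i : Fin N) :
    ContinuousOn (fun t => x t i) (Ici T₁) := by
  intro t ht
  have ht : T₁ ≤ t := ht
  have hT : T₁ ≤ t + 1 := by linarith
  have h := intervalIntegral.continuousOn_primitive_interval' (hloop i (t + 1) hT).1 left_mem_uIcc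
  rw [uIcc_of_le hT] at h
  have h2 : ContinuousOn (fun t => x t i) (Icc T₁ (t + 1)) :=
    (h.const_add (x T₁ i)).congr fun s hs => (hloop i s hs.1).2
  refine (h2 t ⟨ht, by linarith⟩).mono_of_mem_nhdsWithin ?_
  rw [← Ici_inter_Iic]
  exact inter_mem self_mem_nhdsWithin (mem_nhdsWithin_of_mem_nhds (Iic_mem_nhds (by linarith)))

theorem IsClosedLoopFrom.continuousOn_norm_sub (hloop : IsClosedLoopFrom r ε l c T₁ x)
    (i j : Fin N) : ContinuousOn (fun t => ‖x t i - x t j‖) (Ici T₁) :=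
  ((hloop.continuousOn i).sub (hloop.continuousOn j)).norm

theorem IsClosedLoopFrom.eventually_adj_iff (hloop : IsClosedLoopFrom r ε l c T₁ x)
    (hε : 0 < ε) (hT₁ : 0 ≤ T₁) {t : ℝ} (ht : T₁ ≤ t)
    (hlt : ∀ i j, (connGraph r ε x t).Adj i j → ‖x t i - x t j‖ < r) (i j : Fin N) :
    ∀ᶠ s in 𝓝[≥] t, ((connGraph r ε x s).Adj i j ↔ (connGraph r ε x t).Adj i j) :=
  connGraph_adj_iff_eventually_right hε (hT₁.trans ht)
    ((hloop.continuousOn_norm_sub i j t ht).mono (Ici_subset_Ici.2 ht)) (hlt i j)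

theorem sq_sub_sq_norm_pos {E : Type*} [NormedAddCommGroup E] {z : E} (h : ‖z‖ < r) :
    0 < r ^ 2 - ‖z‖ ^ 2 := by
  nlinarith [norm_nonneg z]

theorem IsClosedLoopFrom.continuousWithinAt_edgeWeight (hloop : IsClosedLoopFrom r ε l c T₁ x)
    (hε : 0 < ε) (hT₁ : 0 ≤ T₁) {t : ℝ} (ht : T₁ ≤ t)
    (hlt : ∀ i j, (connGraph r ε x t).Adj i j → ‖x t i - x t j‖ < r) (i j : Fin N) :
    ContinuousWithinAt (fun s => edgeWeight r ε x s i j) (Ici t) t := by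
  have hev := hloop.eventually_adj_iff hε hT₁ ht hlt i j
  by_cases h : (connGraph r ε x t).Adj i j
  · have hd : ContinuousWithinAt (fun t => ‖x t i - x t j‖) (Ici t) t :=
      (hloop.continuousOn_norm_sub i j t ht).mono (Ici_subset_Ici.2 ht)
    have hne := (sq_sub_sq_norm_pos (hlt i j h)).ne'
    have hc : ContinuousWithinAt
        (fun s => 2 * r ^ 2 / (r ^ 2 - ‖x s i - x s j‖ ^ 2) ^ 2) (Ici t) t :=
      continuousWithinAt_const.div ((continuousWithinAt_const.sub (hd.pow 2)).pow 2)
        (pow_ne_zero 2 hne)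
    refine hc.congr_of_eventuallyEq ?_ (if_pos h)
    filter_upwards [hev] with s hs using if_pos (hs.2 h)
  · refine (continuousWithinAt_const (b := (0 : ℝ))).congr_of_eventuallyEq ?_ (if_neg h)
    filter_upwards [hev] with s hs using if_neg fun h' => h (hs.1 h')

/-- The graph is locally constant to the right, so the input is right-continuous and the integral
equation can be differentiated from the right at every time. -/
theorem IsClosedLoopFrom.hasDerivWithinAt (hloop : IsClosedLoopFrom r ε l c T₁ x)
    (hε : 0 < ε) (hT₁ : 0 ≤ T₁) {t : ℝ} (ht : T₁ ≤ t)
    (hlt : ∀ i j, (connGraph r ε x t).Adj i j → ‖x t i - x t j‖ < r) (i : Fin N) :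
    HasDerivWithinAt (fun s => x s i) (controlInput r ε (leaderIndicator l) c x t i)
      (Ici t) t := by
  have hx : ∀ j, ContinuousWithinAt (fun s => x s j) (Ici t) t := fun j =>
    (hloop.continuousOn j t ht).mono (Ici_subset_Ici.2 ht)
  have hcont : ContinuousWithinAt
      (fun s => controlInput r ε (leaderIndicator l) c x s i) (Ici t) t := by
    simp only [controlInput_eq]
    have hw := hloop.continuousWithinAt_edgeWeight hε hT₁ ht hlt i
    have hsum : ContinuousWithinAt
        (fun s => ∑ j, edgeWeight r ε x s i j • (x s i - x s j)) (Ici t) t :=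
      tendsto_finsetSum Finset.univ fun j _ => (hw j).smul ((hx i).sub (hx j))
    fun_prop
  have hmeas : StronglyMeasurableAtFilter
      (fun s => controlInput r ε (leaderIndicator l) c x s i) (𝓝[>] t) := by
    refine ⟨Ioc T₁ (t + 1), ?_, (hloop i (t + 1) (by linarith)).1.1.aestronglyMeasurable⟩
    exact mem_of_superset (Ioc_mem_nhdsGT (by linarith : t < t + 1)) (Ioc_subset_Ioc_left ht)
  have h := intervalIntegral.integral_hasDerivWithinAt_right (hloop i t ht).1 (s := Ici t)
    (t := Ioi t) hmeas (hcont.mono Ioi_subset_Ici_self)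
  exact (h.const_add (x T₁ i)).congr (fun s hs => (hloop i s (ht.trans hs)).2) (hloop i t ht).2

/-! ### Barrier energy and its dissipation -/

open Classical in
/-- The barrier potential of the pair `{i, j}` at time `t`, normalised to vanish at the distance
`r - ε` at which edges are created; zero when the pair is not an edge. -/
noncomputable def barrierExcess (r ε : ℝ) (x : ℝ → Fin N → Plane) (t : ℝ) (i j : Fin N) : ℝ :=
  if (connGraph r ε x t).Adj i j then
    r ^ 2 / (r ^ 2 - ‖x t i - x t j‖ ^ 2) - r ^ 2 / (r ^ 2 - (r - ε) ^ 2) else 0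

theorem IsClosedLoopFrom.hasDerivWithinAt_barrierExcess (hloop : IsClosedLoopFrom r ε l c T₁ x)
    (hε : 0 < ε) (hT₁ : 0 ≤ T₁) {t : ℝ} (ht : T₁ ≤ t)
    (hlt : ∀ i j, (connGraph r ε x t).Adj i j → ‖x t i - x t j‖ < r) (i j : Fin N) :
    HasDerivWithinAt (fun s => barrierExcess r ε x s i j)
      (edgeWeight r ε x t i j * inner ℝ (x t i - x t j)
        (controlInput r ε (leaderIndicator l) c x t i -
          controlInput r ε (leaderIndicator l) c x t j)) (Ici t) t := by
  have hev := hloop.eventually_adj_iff hε hT₁ ht hlt i j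
  by_cases h : (connGraph r ε x t).Adj i j
  · have hne := (sq_sub_sq_norm_pos (hlt i j h)).ne'
    have hz := (hloop.hasDerivWithinAt hε hT₁ ht hlt i).sub
      (hloop.hasDerivWithinAt hε hT₁ ht hlt j)
    have hq := ((hasDerivWithinAt_const t (Ici t) (r ^ 2)).div
      (hz.norm_sq.const_sub (r ^ 2)) hne).sub_const (r ^ 2 / (r ^ 2 - (r - ε) ^ 2))
    refine HasDerivWithinAt.congr_deriv (hq.congr_of_eventuallyEq
      (f₁ := fun s => barrierExcess r ε x s i j) ?_ (if_pos h)) ?_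
    · filter_upwards [hev] with s hs using if_pos (hs.2 h)
    · simp only [edgeWeight, if_pos h, Pi.sub_apply]
      ring
  · simp only [edgeWeight, if_neg h, zero_mul]
    refine (hasDerivWithinAt_const t (Ici t) (0 : ℝ)).congr_of_eventuallyEq ?_ (if_neg h)
    filter_upwards [hev] with s hs using if_neg fun h' => h (hs.1 h')

theorem IsClosedLoopFrom.continuousOn_barrierExcess (hloop : IsClosedLoopFrom r ε l c T₁ x)
    (hε : 0 < ε) (hT₁ : 0 ≤ T₁) {b : ℝ}
    (hlt : ∀ t ∈ Icc T₁ b, ∀ i j, (connGraph r ε x t).Adj i j → ‖x t i - x t j‖ < r)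
    (i j : Fin N) : ContinuousOn (fun s => barrierExcess r ε x s i j) (Icc T₁ b) := by
  intro t ht
  have hright := (hloop.hasDerivWithinAt_barrierExcess hε hT₁ ht.1
    (hlt t ht) i j).continuousWithinAt
  rcases ht.1.eq_or_lt with rfl | htT
  · exact hright.mono Icc_subset_Ici_self
  suffices hleft : ContinuousWithinAt (fun s => barrierExcess r ε x s i j) (Iio t) t by
    have := hleft.union hright
    rw [Iio_union_Ici] at this
    exact this.mono (subset_univ _)
  have hd : ContinuousWithinAt (fun s => ‖x s i - x s j‖) (Iio t) t :=
    ((hloop.continuousOn_norm_sub i j).continuousAt (Ici_mem_nhds htT)).continuousWithinAt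
  have hpast : ∀ᶠ s in 𝓝[<] t, s ∈ Ico T₁ t := Ico_mem_nhdsLT htT
  have h0 : 0 < t := hT₁.trans_lt htT
  by_cases h : (connGraph r ε x t).Adj i j
  · have hF : ContinuousWithinAt (fun s => r ^ 2 / (r ^ 2 - ‖x s i - x s j‖ ^ 2) -
        r ^ 2 / (r ^ 2 - (r - ε) ^ 2)) (Iio t) t :=
      (continuousWithinAt_const.div (continuousWithinAt_const.sub (hd.pow 2))
        (sq_sub_sq_norm_pos (hlt t ht i j h)).ne').sub continuousWithinAt_const
    have hev : (∀ᶠ s in 𝓝[<] t, (connGraph r ε x s).Adj i j) →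
        ContinuousWithinAt (fun s => barrierExcess r ε x s i j) (Iio t) t := fun hev => by
      refine hF.congr_of_eventuallyEq ?_ (if_pos h)
      filter_upwards [hev] with s hs using if_pos hs
    rcases lt_trichotomy ‖x t i - x t j‖ (r - ε) with hdt | hdt | hdt
    · refine hev ?_
      have hpos : ∀ᶠ s in 𝓝[<] t, s ∈ Ioo 0 t := Ioo_mem_nhdsLT h0
      filter_upwards [hpos, hd.eventually (eventually_lt_nhds hdt)] with s hs hs'
      exact (connGraph_pos hε x hs.1 i j).2 ⟨h.1, Or.inl hs'.le⟩
    -- The edge may be born exactly now. Whether or not it was present just before, the excess is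
    -- bounded by the shifted barrier, which tends to zero.
    · have hFt : barrierExcess r ε x t i j = 0 := by
        simp only [barrierExcess, if_pos h, hdt, sub_self]
      rw [ContinuousWithinAt, hFt]
      have hF0 := hF.tendsto.norm
      rw [hdt, sub_self, norm_zero] at hF0
      refine squeeze_zero_norm (fun s => ?_) hF0
      unfold barrierExcess
      split_ifs
      · exact le_rfl
      · rw [norm_zero]
        exact norm_nonneg _
    · rcases ((connGraph_pos hε x h0 i j).1 h).2 with h' | h'
      · exact absurd h' (not_le.2 hdt)
      · exact hev h'.2
  · refine (continuousWithinAt_const (b := (0 : ℝ))).congr_of_eventuallyEq ?_ (if_neg h)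
    filter_upwards [hpast] with s hs
    refine if_neg fun h' => h ?_
    refine connGraph_mono hs.2.le ((hloop.continuousOn_norm_sub i j).mono fun u hu =>
      hs.1.trans hu.1) (fun u hu => hlt u ⟨hs.1.trans hu.1, hu.2.trans ht.2⟩ i j) h'

/-- The Lyapunov function of the closed loop. -/
noncomputable def loopEnergy (r ε : ℝ) (l : Fin N) (c : Fin N → Plane)
    (x : ℝ → Fin N → Plane) (t : ℝ) : ℝ :=
  ‖x t l - c l‖ ^ 2 / 2 + (∑ i, ∑ j, barrierExcess r ε x t i j) / 2

theorem sum_leaderIndicator_mul (l : Fin N) (f : Fin N → ℝ) :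
    ∑ i, leaderIndicator l i * f i = f l := by
  simp [leaderIndicator]

/-- Used twice: with `v` the input itself for energy dissipation, and with `v i = x t i - c l` for
the decay. -/
theorem sum_inner_controlInput (t : ℝ) (v : Fin N → Plane) :
    ∑ i, inner ℝ (controlInput r ε (leaderIndicator l) c x t i) (v i) =
      -inner ℝ (x t l - c l) (v l) - (∑ i, ∑ j, edgeWeight r ε x t i j *
        inner ℝ (x t i - x t j) (v i - v j)) / 2 := by
  rw [← sum_inner_laplacian (edgeWeight_symm r ε x t),
    ← sum_leaderIndicator_mul l fun i => inner ℝ (x t i - c i) (v i)]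
  simp only [controlInput_eq, inner_sub_left (-(_ : Plane)), inner_neg_left,
    real_inner_smul_left, Finset.sum_sub_distrib, Finset.sum_neg_distrib]

theorem IsClosedLoopFrom.loopEnergy_le (hloop : IsClosedLoopFrom r ε l c T₁ x)
    (hε : 0 < ε) (hT₁ : 0 ≤ T₁) {b : ℝ} (hb : T₁ ≤ b)
    (hlt : ∀ t ∈ Icc T₁ b, ∀ i j, (connGraph r ε x t).Adj i j → ‖x t i - x t j‖ < r) :
    loopEnergy r ε l c x b ≤ loopEnergy r ε l c x T₁ := by
  refine le_of_deriv_right_nonpos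
    (f' := fun t => -∑ i, ‖controlInput r ε (leaderIndicator l) c x t i‖ ^ 2) hb ?_ ?_ ?_
  · refine ContinuousOn.add (ContinuousOn.div_const (ContinuousOn.pow (ContinuousOn.norm
      (((hloop.continuousOn l).mono Icc_subset_Ici_self).sub continuousOn_const)) 2) 2)
      (ContinuousOn.div_const ?_ 2)
    exact continuousOn_finsetSum _ fun i _ => continuousOn_finsetSum _ fun j _ =>
      hloop.continuousOn_barrierExcess hε hT₁ hlt i j
  · intro t ht
    have hlt' := hlt t ⟨ht.1, ht.2.le⟩
    have h1 := ((hloop.hasDerivWithinAt hε hT₁ ht.1 hlt' l).sub_const (c l)).norm_sq.div_const 2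
    have h2 := (HasDerivWithinAt.fun_sum fun i (_ : i ∈ Finset.univ) =>
      HasDerivWithinAt.fun_sum fun j (_ : j ∈ Finset.univ) =>
        hloop.hasDerivWithinAt_barrierExcess hε hT₁ ht.1 hlt' i j).div_const 2
    refine (h1.add h2).congr_deriv ?_
    simp only [← real_inner_self_eq_norm_sq]
    rw [sum_inner_controlInput]
    ring
  · intro t _
    exact neg_nonpos.2 (Finset.sum_nonneg fun i _ => by positivity)

/-! ### Preservation of edges -/

theorem neg_le_barrierExcess {t : ℝ} (hε : 0 < ε) (hεr : ε < r)
    (hlt : ∀ i j, (connGraph r ε x t).Adj i j → ‖x t i - x t j‖ < r) (i j : Fin N) :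
    -(r ^ 2 / (r ^ 2 - (r - ε) ^ 2)) ≤ barrierExcess r ε x t i j := by
  have hW : 0 ≤ r ^ 2 / (r ^ 2 - (r - ε) ^ 2) := div_nonneg (sq_nonneg r) (by nlinarith)
  unfold barrierExcess
  split_ifs with h
  · have := div_nonneg (sq_nonneg r) (sq_sub_sq_norm_pos (hlt i j h)).le
    linarith
  · linarith

theorem exists_sq_le_mul_of_loopEnergy_le (hε : 0 < ε) (hεr : ε < r) (V : ℝ) :
    ∃ K : ℝ, ∀ t, loopEnergy r ε l c x t ≤ V →
      (∀ i j, (connGraph r ε x t).Adj i j → ‖x t i - x t j‖ < r) →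
      ∀ i j, (connGraph r ε x t).Adj i j → r ^ 2 ≤ K * (r ^ 2 - ‖x t i - x t j‖ ^ 2) := by
  set W := r ^ 2 / (r ^ 2 - (r - ε) ^ 2) with hWdef
  have hW : 0 ≤ W := div_nonneg (sq_nonneg r) (by nlinarith)
  -- Adding `W` makes all `N²` excesses nonnegative, so one of them is at most the whole sum. The
  -- division-free bound survives a limit in which the distance tends to `r`.
  refine ⟨2 * V + N * (N * W), fun t hV hlt i j h => ?_⟩
  have hlow := neg_le_barrierExcess hε hεr hlt
  have hsum : barrierExcess r ε x t i j + W ≤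
      ∑ i, ∑ j, (barrierExcess r ε x t i j + W) :=
    (Finset.single_le_sum (f := fun j => barrierExcess r ε x t i j + W)
      (fun j _ => by linarith [hlow i j]) (Finset.mem_univ j)).trans
    (Finset.single_le_sum (f := fun i => ∑ j, (barrierExcess r ε x t i j + W))
      (fun i _ => Finset.sum_nonneg fun j _ => by linarith [hlow i j]) (Finset.mem_univ i))
  simp only [Finset.sum_add_distrib, Finset.sum_const, Finset.card_univ, Fintype.card_fin,
    nsmul_eq_mul] at hsum
  have hij : barrierExcess r ε x t i j + W = r ^ 2 / (r ^ 2 - ‖x t i - x t j‖ ^ 2) := by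
    rw [barrierExcess, if_pos h]
    ring
  rw [← div_le_iff₀ (sq_sub_sq_norm_pos (hlt i j h)), ← hij]
  unfold loopEnergy at hV
  nlinarith [sq_nonneg ‖x t l - c l‖]

theorem IsClosedLoopFrom.norm_sub_lt_of_adj (hloop : IsClosedLoopFrom r ε l c T₁ x)
    (hε : 0 < ε) (hεr : ε < r) (hT₁ : 0 ≤ T₁)
    (hlen : ∀ i j, (connGraph r ε x T₁).Adj i j → ‖x T₁ i - x T₁ j‖ < r) {t : ℝ} (ht : T₁ ≤ t)
    (i j : Fin N) (h : (connGraph r ε x t).Adj i j) : ‖x t i - x t j‖ < r := by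
  have hr : 0 < r := hε.trans hεr
  let S : Set ℝ := {s | T₁ ≤ s ∧ ∃ i j, (connGraph r ε x s).Adj i j ∧ r ≤ ‖x s i - x s j‖}
  by_contra! hge
  have hS : S.Nonempty := ⟨t, ht, i, j, h, hge⟩
  have hbdd : BddBelow S := ⟨T₁, fun s hs => hs.1⟩
  set τ := sInf S
  have hτ : T₁ ≤ τ := le_csInf hS fun s hs => hs.1
  have hbefore : ∀ s ∈ Ico T₁ τ, ∀ i j, (connGraph r ε x s).Adj i j → ‖x s i - x s j‖ < r := by
    intro s hs i j h
    by_contra! hge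
    exact absurd (csInf_le hbdd ⟨hs.1, i, j, h, hge⟩) (not_le.2 hs.2)
  -- No violation at `τ`: an edge longer than `r - ε` existed just before, and the energy bound
  -- passes to the limit. With `hafter` this contradicts `τ` being the infimum.
  have hat : ∀ i j, (connGraph r ε x τ).Adj i j → ‖x τ i - x τ j‖ < r := by
    intro i j h
    rcases hτ.eq_or_lt with heq | hlt
    · rw [← heq] at h ⊢
      exact hlen i j h
    rcases ((connGraph_pos hε x (hT₁.trans_lt hlt) i j).1 h).2 with hd | ⟨⟨-, hle⟩, hev⟩
    · linarith
    obtain ⟨K, hK⟩ := exists_sq_le_mul_of_loopEnergy_le (l := l) (c := c) (x := x) hε hεr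
      (loopEnergy r ε l c x T₁)
    have hd : Tendsto (fun s => ‖x s i - x s j‖) (𝓝[<] τ) (𝓝 ‖x τ i - x τ j‖) :=
      ((hloop.continuousOn_norm_sub i j).continuousAt (Ici_mem_nhds hlt)).continuousWithinAt
    have hlim : r ^ 2 ≤ K * (r ^ 2 - ‖x τ i - x τ j‖ ^ 2) := by
      refine ge_of_tendsto (((hd.pow 2).const_sub (r ^ 2)).const_mul K) ?_
      have hpast : ∀ᶠ s in 𝓝[<] τ, s ∈ Ico T₁ τ := Ico_mem_nhdsLT hlt
      filter_upwards [hev, hpast] with s hs hs'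
      exact hK s (hloop.loopEnergy_le hε hT₁ hs'.1 fun u hu =>
        hbefore u ⟨hu.1, hu.2.trans_lt hs'.2⟩) (hbefore s hs') i j hs
    refine lt_of_le_of_ne hle fun heq => ?_
    rw [heq, sub_self, mul_zero] at hlim
    nlinarith
  have hafter : ∀ᶠ s in 𝓝[≥] τ, ∀ i j, (connGraph r ε x s).Adj i j → ‖x s i - x s j‖ < r := by
    refine eventually_all.2 fun i => eventually_all.2 fun j => ?_
    by_cases h : (connGraph r ε x τ).Adj i j
    · have hd : ContinuousWithinAt (fun s => ‖x s i - x s j‖) (Ici τ) τ :=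
        (hloop.continuousOn_norm_sub i j τ hτ).mono (Ici_subset_Ici.2 hτ)
      filter_upwards [hd.eventually (eventually_lt_nhds (hat i j h))] with s hs _ using hs
    · filter_upwards [hloop.eventually_adj_iff hε hT₁ hτ hat i j] with s hs h'
      exact absurd (hs.1 h') h
  obtain ⟨b, hb, hsub⟩ := mem_nhdsGE_iff_exists_Ico_subset.1 hafter
  obtain ⟨s, hs, hsb⟩ := exists_lt_of_csInf_lt hS (show τ < b from hb)
  obtain ⟨-, i, j, h, hge⟩ := id hs
  exact absurd (hsub ⟨csInf_le hbdd hs, hsb⟩ i j h) (not_lt.2 hge)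

/-! ### Exponential convergence to the leader's goal -/

theorem IsClosedLoopFrom.exists_sum_norm_sq_le_exp (hloop : IsClosedLoopFrom r ε l c T₁ x)
    (hε : 0 < ε) (hεr : ε < r) (hT₁ : 0 ≤ T₁) (hconn : (connGraph r ε x T₁).Connected)
    (hlen : ∀ i j, (connGraph r ε x T₁).Adj i j → ‖x T₁ i - x T₁ j‖ < r) :
    ∃ κ > 0, ∀ t, T₁ ≤ t → ∑ i, ‖x t i - c l‖ ^ 2 ≤
      Real.exp (-(κ * (t - T₁))) * ∑ i, ‖x T₁ i - c l‖ ^ 2 := by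
  have hr : 0 < r := hε.trans hεr
  have hlt : ∀ t, T₁ ≤ t → ∀ i j, (connGraph r ε x t).Adj i j → ‖x t i - x t j‖ < r :=
    fun t ht => hloop.norm_sub_lt_of_adj hε hεr hT₁ hlen ht
  obtain ⟨C, hC, hpoincare⟩ := exists_sum_norm_sq_le (E := Plane) hconn l
    (show 0 < 2 / r ^ 2 by positivity)
  refine ⟨1 / C, by positivity, fun b hb => ?_⟩
  have hmono : Real.exp (1 / C * (b - T₁)) * ∑ i, ‖x b i - c l‖ ^ 2 ≤
      Real.exp (1 / C * (T₁ - T₁)) * ∑ i, ‖x T₁ i - c l‖ ^ 2 := by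
    refine le_of_deriv_right_nonpos
      (f := fun t => Real.exp (1 / C * (t - T₁)) * ∑ i, ‖x t i - c l‖ ^ 2)
      (f' := fun t => Real.exp (1 / C * (t - T₁)) * (1 / C * ∑ i, ‖x t i - c l‖ ^ 2 +
        2 * ∑ i, inner ℝ (controlInput r ε (leaderIndicator l) c x t i) (x t i - c l)))
      hb ?_ ?_ ?_
    · refine ContinuousOn.mul (by fun_prop) (continuousOn_finsetSum _ fun i _ => ?_)
      exact ((((hloop.continuousOn i).mono Icc_subset_Ici_self).sub continuousOn_const).norm).pow 2
    · intro t ht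
      have h1 : HasDerivWithinAt (fun t => Real.exp (1 / C * (t - T₁)))
          (Real.exp (1 / C * (t - T₁)) * (1 / C * 1)) (Ici t) t :=
        ((((hasDerivAt_id t).sub_const T₁).const_mul (1 / C)).exp).hasDerivWithinAt
      have h2 := HasDerivWithinAt.fun_sum fun i (_ : i ∈ Finset.univ) =>
        ((hloop.hasDerivWithinAt hε hT₁ ht.1 (hlt t ht.1) i).sub_const (c l)).norm_sq
      refine (h1.mul h2).congr_deriv ?_
      simp only [← Finset.mul_sum, real_inner_comm (controlInput _ _ _ _ _ _ _)]
      ring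
    · intro t ht
      refine mul_nonpos_of_nonneg_of_nonpos (Real.exp_nonneg _) ?_
      -- The inequality is applied on the fixed graph `G(T₁)`, whose edges all persist; edges added
      -- later only contribute nonnegative terms.
      have hP := hpoincare (edgeWeight r ε x t) (fun i => x t i - c l)
        (edgeWeight_nonneg r ε x t) fun i j h => two_div_sq_le_edgeWeight
          (connGraph_mono ht.1 ((hloop.continuousOn_norm_sub i j).mono Icc_subset_Ici_self)
            (fun s hs => hlt s hs.1 i j) h) (hlt t ht.1 i j
          (connGraph_mono ht.1 ((hloop.continuousOn_norm_sub i j).mono Icc_subset_Ici_self)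
            (fun s hs => hlt s hs.1 i j) h))
      simp only [sub_sub_sub_cancel_right] at hP
      rw [sum_inner_controlInput]
      simp only [sub_sub_sub_cancel_right, real_inner_self_eq_norm_sq]
      rw [← div_le_iff₀' hC, div_eq_inv_mul, ← one_div] at hP
      linarith
  rw [sub_self, mul_zero, Real.exp_zero, one_mul] at hmono
  rw [Real.exp_neg, ← div_eq_inv_mul, le_div_iff₀' (Real.exp_pos _)]
  exact hmono

theorem IsClosedLoopFrom.tendsto (hloop : IsClosedLoopFrom r ε l c T₁ x)
    (hε : 0 < ε) (hεr : ε < r) (hT₁ : 0 ≤ T₁) (hconn : (connGraph r ε x T₁).Connected)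
    (hlen : ∀ i j, (connGraph r ε x T₁).Adj i j → ‖x T₁ i - x T₁ j‖ < r) (i : Fin N) :
    Tendsto (fun t => x t i) atTop (𝓝 (c l)) := by
  obtain ⟨κ, hκ, hdecay⟩ := hloop.exists_sum_norm_sq_le_exp hε hεr hT₁ hconn hlen
  have hexp : Tendsto (fun t => Real.exp (-(κ * (t - T₁))) * ∑ i, ‖x T₁ i - c l‖ ^ 2)
      atTop (𝓝 0) := by
    rw [← zero_mul (∑ i, ‖x T₁ i - c l‖ ^ 2)]
    refine Tendsto.mul_const _ (Real.tendsto_exp_neg_atTop_nhds_zero.comp ?_)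
    exact (tendsto_atTop_add_const_right _ _ tendsto_id).const_mul_atTop hκ
  have hsq : Tendsto (fun t => ‖x t i - c l‖ ^ 2) atTop (𝓝 0) := by
    refine squeeze_zero' (Eventually.of_forall fun t => sq_nonneg _) ?_ hexp
    filter_upwards [eventually_ge_atTop T₁] with t ht
    exact (Finset.single_le_sum (f := fun i => ‖x t i - c l‖ ^ 2) (fun i _ => sq_nonneg _)
      (Finset.mem_univ i)).trans (hdecay t ht)
  rw [tendsto_iff_norm_sub_tendsto_zero]
  simpa [Real.sqrt_sq] using hsq.sqrt

end LeaderFollower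

theorem lemma2 {N : ℕ} (r ε : ℝ) (hε : 0 < ε) (hεr : ε < r)
    (l : Fin N) (c : Fin N → Plane) (ρ : ℝ) (hρ : 0 < ρ)
    (T₁ : ℝ) (hT₁ : 0 ≤ T₁) (x : ℝ → Fin N → Plane)
    (hconn : (LeaderFollower.connGraph r ε x T₁).Connected)
    (hlen : ∀ i j, (LeaderFollower.connGraph r ε x T₁).Adj i j → ‖x T₁ i - x T₁ j‖ < r)
    (hloop : LeaderFollower.IsClosedLoopFrom r ε l c T₁ x) :
    (∃ t, T₁ ≤ t ∧ ∀ i, x t i ∈ LeaderFollower.goalRegion (c l) ρ) ∧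
      ∀ i, Filter.Tendsto (fun t => x t i) Filter.atTop (nhds (c l)) := by
  have h := hloop.tendsto hε hεr hT₁ hconn hlen
  refine ⟨?_, h⟩
  have hnear : ∀ᶠ t in atTop, ∀ i, ‖x t i - c l‖ ≤ ρ := eventually_all.2 fun i =>
    (tendsto_iff_norm_sub_tendsto_zero.1 (h i)).eventually_le_const hρ
  obtain ⟨t, ht, hball⟩ := ((eventually_ge_atTop T₁).and hnear).exists
  exact ⟨t, ht, hball⟩
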